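/- Let $D$ be a (non-empty) link diagram in the solid torus, drawn in the punctured disc $D^2\setminus\{0\}$; the puncture is called the dot. A crossing $c$ of $D$ is called nugatory if there is a simple closed curve in the punctured disc which meets $D$ only in the double point $c$, where it passes between opposite corners of the crossing. A nugatory crossing is called dotted-irreducible if no such curve is contractible in the solid torus, i.e. if each such curve separates the dot from the outer boundary of the disc. The diagram $D$ is called dotted-reduced if all its nugatory crossings (if there are any) are dotted-irreducible, and alternating if over- and undercrossings alternate along each of its components. A state $S$ of $D$ is a choice of an $A$- or a $B$-smoothing at each crossing. Here the $A$-smoothing is the one which joins the two regions swept by the over-strand when it is turned counterclockwise, and the $B$-smoothing is the other one. Let $a(S)$ and $b(S)$ be the numbers of $A$- and of $B$-smoothings in $S$, let $|S|$ be the number of circles of the smoothed diagram, and let $|T_S|$ be the number of those circles that go around the dot, i.e. separate it from the outer boundary. The contribution of $S$ and the Kauffman bracket of $D$ are $$\langle D\,|\,S\rangle = A^{a(S)-b(S)}\,(-A^{2}-A^{-2})^{|S|-1}\,t^{|T_S|},\qquad \langle D\rangle=\sum_{S}\langle D\,|\,S\rangle\ \in\ \mathbb Z[A^{\pm1},t].$$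 Let $S_A$ be the state with an $A$-smoothing at every crossing, $S_B$ the state with a $B$-smoothing at every crossing, and let $\max\deg_A$ and $\min\deg_A$ denote the largest and the smallest exponent of $A$ that occurs with a non-zero coefficient in $\mathbb Z[t]$. **Theorem.** If $D$ is alternating and dotted-reduced, then $$\max\deg_A\langle D\rangle=\max\deg_A\langle D\,|\,S_A\rangle\qquad\text{and}\qquad \min\deg_A\langle D\rangle=\min\deg_A\langle D\,|\,S_B\rangle .$$ -/

import Mathlib

/-!
Link diagrams in the solid torus, drawn in the punctured disc (an annulus), as planar diagram
codes.

The annulus is the sphere with two points removed: the "dot" (the puncture) and a point outside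
the outer boundary.  At a crossing `x` the four ends of edges are `(x, 0), (x, 1), (x, 2), (x, 3)`
in counterclockwise order; `(x, 0)` and `(x, 2)` form the under-strand, `(x, 1)` and `(x, 3)` the
over-strand.  The *corner* `(x, i)` is the sector at `x` between the ends `(x, i)` and
`(x, i + 1)`; it lies to the left of the edge that leaves `x` through the end `(x, i)`, and the
corner `(x, i - 1)` lies to its right.
-/

namespace SolidTorus

open LaurentPolynomial

/-- Walk along the boundary of a region, keeping the region on the left: leave the crossing
through the end `(x, i)`, arrive at the end `glue (x, i) = (y, j)`; the region is then seen in the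
corner `(y, j - 1)`.  The cycles of this permutation are the boundary cycles of the regions
(as far as they contain crossings). -/
def boundaryWalk {X : Type*} (glue : Equiv.Perm (X × Fin 4)) : Equiv.Perm (X × Fin 4) :=
  glue.trans ((Equiv.refl X).prodCongr (Equiv.subRight (1 : Fin 4)))

/-- A link diagram in the solid torus.  `X` is the set of crossings, `C` the set of components
without crossings (simple closed curves disjoint from the rest of the diagram) and `R` the set of
regions, i.e. connected components of the complement of the diagram in the sphere.  The diagram
need not be connected, so a region may have several boundary cycles. -/
structure Diagram (X C R : Type*) [Fintype X] [Fintype C] [Fintype R] where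
  /-- the other end of the edge that starts at a given end -/
  glue : Equiv.Perm (X × Fin 4)
  glue_ne : ∀ d, glue d ≠ d
  glue_glue : ∀ d, glue (glue d) = d
  /-- the region that contains a given corner -/
  region : X × Fin 4 → R
  region_boundaryWalk : ∀ d, region (boundaryWalk glue d) = region d
  /-- the regions on the two sides of a component without crossings -/
  side : C → Bool → R
  /-- the region that contains the dot -/
  dot : R
  /-- the region that contains the outer boundary of the punctured disc -/
  outer : R
  /-- the link is not empty -/
  nonempty : Nonempty (X ⊕ C)
  /-- The surface that carries the diagram is connected: one gets from any region to any other by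
  crossing edges and components without crossings. -/
  connected : ∀ r r' : R, Relation.EqvGen
    (fun p q => (∃ x i, p = region (x, i) ∧ q = region (x, i - 1)) ∨
      (∃ k, p = side k false ∧ q = side k true)) r r'
  /-- The surface that carries the diagram has Euler characteristic `2`, so it is the sphere.
  With `V` crossings, `E = 2 V` edges and planar regions `r` that have `b r` boundary cycles each,
  the Euler characteristic is `V - E + ∑ r, (2 - b r)`. A component without crossings contributes
  two boundary cycles. -/
  euler : Fintype.card X + 2 * Fintype.card R =
    2 * Fintype.card X +
      (Nat.card (Quotient (Equiv.Perm.SameCycle.setoid (boundaryWalk glue))) +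
        2 * Fintype.card C) + 2

/-- The two ways to smooth a crossing. -/
inductive Smoothing
  | A
  | B
  deriving DecidableEq

instance : Fintype Smoothing :=
  ⟨{Smoothing.A, Smoothing.B}, fun s => by cases s <;> simp⟩

/-- The end at the same crossing to which a smoothing joins a given end.  The `A`-smoothing
joins `0` with `1` and `2` with `3` (it opens the two corners that the over-strand sweeps when it is
turned counterclockwise); the `B`-smoothing joins `1` with `2` and `3` with `0`. -/
def Smoothing.join : Smoothing → Fin 4 → Fin 4
  | .A => ![1, 0, 3, 2]
  | .B => ![3, 2, 1, 0]

/-- One of the two corners that a smoothing merges; the other is the opposite one. -/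
def Smoothing.opened : Smoothing → Fin 4
  | .A => 1
  | .B => 0

namespace Diagram

variable {X C R : Type*} [Fintype X] [Fintype C] [Fintype R]

/-- Along every component, over- and undercrossings alternate: each edge joins an end of an
over-strand (`1` or `3`) to an end of an under-strand (`0` or `2`). -/
def Alternating (D : Diagram X C R) : Prop :=
  ∀ d : X × Fin 4, ((D.glue d).2 = 1 ∨ (D.glue d).2 = 3) ↔ ¬ (d.2 = 1 ∨ d.2 = 3)

/-! ### Nugatory crossings -/

/-- A simple closed curve in the annulus that meets the diagram only in the double point of the
crossing `c`, and passes there from one side of the diagram to the other, i.e. between two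
opposite corners.  The curve is recorded by what it has on its two sides (`true` and `false`).
It runs inside one region, that of the corner `(c, corner)`, which it cuts in two; all the other
regions, all edges and components without crossings, the dot and the outer boundary lie on one
side each. -/
structure CurveThrough (D : Diagram X C R) (c : X) where
  /-- the curve runs through the corners `corner` and `corner + 2` at `c` -/
  corner : Fin 4
  edgeSide : X × Fin 4 → Bool
  circleSide : C → Bool
  /-- meaningful only for the regions that the curve does not cut -/
  regionSide : R → Bool
  dotSide : Bool
  outerSide : Bool
  edge_glue : ∀ d, edgeSide (D.glue d) = edgeSide d
  edge_crossing : ∀ x, x ≠ c → ∀ i j, edgeSide (x, i) = edgeSide (x, j)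
  edge_zero : edgeSide (c, corner) = false
  edge_one : edgeSide (c, corner + 1) = true
  edge_two : edgeSide (c, corner + 2) = true
  edge_three : edgeSide (c, corner + 3) = false
  region_edge : ∀ d, D.region d ≠ D.region (c, corner) → edgeSide d = regionSide (D.region d)
  region_circle : ∀ k b, D.side k b ≠ D.region (c, corner) →
    circleSide k = regionSide (D.side k b)
  region_dot : D.dot ≠ D.region (c, corner) → dotSide = regionSide D.dot
  region_outer : D.outer ≠ D.region (c, corner) → outerSide = regionSide D.outer

/-- A simple closed curve in the annulus is contractible in the solid torus if and only if it does
not separate the dot from the outer boundary. -/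
def CurveThrough.Contractible {D : Diagram X C R} {c : X} (γ : D.CurveThrough c) : Prop :=
  γ.dotSide = γ.outerSide

/-- A crossing is nugatory if there is a (separating) simple closed curve that meets the diagram
only in this crossing.  Every simple closed curve in the annulus separates it. -/
def Nugatory (D : Diagram X C R) (c : X) : Prop :=
  Nonempty (D.CurveThrough c)

/-- A nugatory crossing is dotted-irreducible if no such curve is contractible. -/
def DottedIrreducible (D : Diagram X C R) (c : X) : Prop :=
  D.Nugatory c ∧ ¬ ∃ γ : D.CurveThrough c, γ.Contractible

/-- All nugatory crossings (if there are any) are dotted-irreducible. -/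
def DottedReduced (D : Diagram X C R) : Prop :=
  ∀ c, D.Nugatory c → D.DottedIrreducible c

/-! ### States and the bracket -/

/-- Two ends of edges lie on the same circle of the state `s`. -/
def circleSetoid (D : Diagram X C R) (s : X → Smoothing) : Setoid (X × Fin 4) :=
  Relation.EqvGen.setoid
    (fun d e => e = D.glue d ∨ e = (d.1, (s d.1).join d.2))

/-- The circles of a state: those that run through edges of the diagram, and the components
without crossings. -/
abbrev Circle (D : Diagram X C R) (s : X → Smoothing) : Type _ :=
  Quotient (D.circleSetoid s) ⊕ C

/-- The circle of the state `s` through a given end. -/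
def circleOf (D : Diagram X C R) (s : X → Smoothing) (d : X × Fin 4) : D.Circle s :=
  Sum.inl (Quotient.mk (D.circleSetoid s) d)

/-- One gets from the region `p` to the region `q` without meeting the state circle `γ`: across an
edge or a component without crossings that is not part of `γ`, or between the two corners of a
crossing that are merged by its smoothing. -/
inductive Step (D : Diagram X C R) (s : X → Smoothing) (γ : D.Circle s) : R → R → Prop
  | edge (x : X) (i : Fin 4) (h : D.circleOf s (x, i) ≠ γ) :
      Step D s γ (D.region (x, i)) (D.region (x, i - 1))
  | circle (k : C) (h : Sum.inr k ≠ γ) : Step D s γ (D.side k false) (D.side k true)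
  | opened (x : X) :
      Step D s γ (D.region (x, (s x).opened)) (D.region (x, (s x).opened + 2))

/-- The state circle `γ` goes around the dot: it separates the dot from the outer boundary, that
is, they lie in different connected components of the complement of `γ`. -/
def AroundDot (D : Diagram X C R) (s : X → Smoothing) (γ : D.Circle s) : Prop :=
  ¬ Relation.EqvGen (D.Step s γ) D.dot D.outer

/-- The number `|S|` of circles of a state. -/
noncomputable def numCircles (D : Diagram X C R) (s : X → Smoothing) : ℕ :=
  Nat.card (D.Circle s)

/-- The number `|T|` of circles of a state that go around the dot. -/
noncomputable def numAroundDot (D : Diagram X C R) (s : X → Smoothing) : ℕ :=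
  Nat.card {γ : D.Circle s // D.AroundDot s γ}

/-- The contribution `A ^ (a(S) - b(S)) * (-A ^ 2 - A ^ (-2)) ^ (|S| - 1) * t ^ |T|` of a state, as
a Laurent polynomial in `A` (`T n` is `A ^ n`) with coefficients in `ℤ[t]`. -/
noncomputable def contribution (D : Diagram X C R) (s : X → Smoothing) :
    LaurentPolynomial (Polynomial ℤ) :=
  T (((Finset.univ.filter fun x => s x = Smoothing.A).card : ℤ) -
      ((Finset.univ.filter fun x => s x = Smoothing.B).card : ℤ)) *
    (-T 2 - T (-2)) ^ (D.numCircles s - 1) *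
    LaurentPolynomial.C (Polynomial.X ^ D.numAroundDot s)

/-- The Kauffman bracket of a diagram in the solid torus, an element of `ℤ[t][A, A⁻¹]`. -/
noncomputable def bracket [DecidableEq X] (D : Diagram X C R) :
    LaurentPolynomial (Polynomial ℤ) :=
  ∑ s : X → Smoothing, D.contribution s

end Diagram

/-- The maximal exponent of `A` (`⊥` for the zero polynomial). -/
noncomputable def maxDegA (f : LaurentPolynomial (Polynomial ℤ)) : WithBot ℤ :=
  f.degree

/-- The minimal exponent of `A` (`⊤` for the zero polynomial). -/
noncomputable def minDegA (f : LaurentPolynomial (Polynomial ℤ)) : WithTop ℤ :=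
  f.coeff.support.min

end SolidTorus

/-! Let `σ` be `A` or `B`. If a state `s` differs from the constant state of `σ` at `n` crossings,
its power of `A` moves inwards by `2n`, while every changed smoothing creates at most one circle and
so regains at most `2`. Hence no state exceeds the constant state (`extremeExponent_le`), and a
state ties with it only if every change cuts a circle in two, in whatever order the changes are
made.

Ties can occur at nugatory crossings, and the variable `t` tells them apart. In an alternating
diagram all corners cut off by one circle of a constant state belong to one region
(`Alternating.insideRegion_eq`). If changing the smoothing at `c` splits such a circle, a curve in
that region follows one half from `c` back to `c` and meets the diagram only there
(`Alternating.exists_curveThrough`). As the diagram is dotted-reduced, the curve separates the dot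
from the outer boundary, so both halves have winding number `1` modulo two and the circle they came
from has `1 + 1 = 0`. Splitting preserves the sum of the winding numbers. So every odd circle of the
constant state leaves an odd circle in a tying state, and the circle split at `c` yields a further
one (`Alternating.numAroundDot_const_lt`). Tying states therefore carry a larger power of `t`, and
the term of the constant state cannot cancel.

Winding numbers come from homology modulo two: a dimension count with Euler's formula shows that
every cycle on the sphere bounds (`exists_jump_eq`), so a state circle is the jump set of a function
on regions. That function takes different values at the dot and at the outer region exactly when the
circle goes around the dot (`aroundDot_iff`). -/

namespace SolidTorus

/-! ### Homology modulo two of the sphere that carries the diagram. -/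

namespace Diagram

variable {X C R : Type*} [Fintype X] [Fintype C] [Fintype R]

/-! ### Cochains modulo two -/

/-- The region to the right of the edge that leaves a crossing through the end `d`. -/
def rightRegion (D : Diagram X C R) (d : X × Fin 4) : R :=
  D.region (d.1, d.2 - 1)

theorem rightRegion_glue (D : Diagram X C R) (d : X × Fin 4) :
    D.rightRegion (D.glue d) = D.region d :=
  D.region_boundaryWalk d

theorem region_glue (D : Diagram X C R) (d : X × Fin 4) :
    D.region (D.glue d) = D.rightRegion d := by
  rw [← D.rightRegion_glue, D.glue_glue]

/-- The coboundary of a function on regions: its jumps across the edges and across the components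
without crossings. -/
def jump (D : Diagram X C R) :
    (R → ZMod 2) →ₗ[ZMod 2] (X × Fin 4 → ZMod 2) × (C → ZMod 2) where
  toFun f := (fun d => f (D.region d) + f (D.rightRegion d),
    fun k => f (D.side k false) + f (D.side k true))
  map_add' f g := by
    ext <;> simp <;> ring
  map_smul' a f := by
    ext <;> simp <;> ring

/-- A function without jumps is constant. -/
theorem eq_of_jump_eq_zero (D : Diagram X C R) {f : R → ZMod 2} (hf : D.jump f = 0) (r r' : R) :
    f r = f r' := by
  have h := D.connected r r'
  induction h with
  | rel p q h =>
    rcases h with ⟨x, i, rfl, rfl⟩ | ⟨k, rfl, rfl⟩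
    · exact CharTwo.add_eq_zero.1 (congrFun (congrArg Prod.fst hf) (x, i))
    · exact CharTwo.add_eq_zero.1 (congrFun (congrArg Prod.snd hf) k)
  | refl => rfl
  | symm _ _ _ ih => exact ih.symm
  | trans _ _ _ _ _ ih₁ ih₂ => exact ih₁.trans ih₂

theorem finrank_le_one_of_forall_eq {ι : Type*} [Fintype ι] (V : Submodule (ZMod 2) (ι → ZMod 2))
    (h : ∀ f ∈ V, ∀ i j, f i = f j) : Module.finrank (ZMod 2) V ≤ 1 := by
  have hle : V ≤ Submodule.span (ZMod 2) {fun _ => 1} := by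
    intro f hf
    rw [Submodule.mem_span_singleton]
    rcases isEmpty_or_nonempty ι with hι | ⟨⟨i⟩⟩
    · exact ⟨0, Subsingleton.elim _ _⟩
    · exact ⟨f i, by ext j; simpa using h f hf i j⟩
  exact (Submodule.finrank_mono hle).trans (finrank_span_le_card _ |>.trans (by simp))

theorem card_le_finrank_range_jump (D : Diagram X C R) :
    Fintype.card R ≤ Module.finrank (ZMod 2) (LinearMap.range D.jump) + 1 := by
  have h := LinearMap.finrank_range_add_finrank_ker D.jump
  have hk := finrank_le_one_of_forall_eq (LinearMap.ker D.jump)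
    fun f hf => D.eq_of_jump_eq_zero (LinearMap.mem_ker.1 hf)
  rw [Module.finrank_fintype_fun_eq_card] at h
  omega

/-! ### Connected components of the diagram -/

/-- Crossings in the same connected component of the diagram. -/
def componentSetoid (D : Diagram X C R) : Setoid X :=
  Relation.EqvGen.setoid fun x y => ∃ i, y = (D.glue (x, i)).1

/-- The connected components of the diagram that have crossings. -/
abbrev Component (D : Diagram X C R) : Type _ :=
  Quotient D.componentSetoid

/-- The boundary cycles of the regions, as far as they contain crossings. -/
abbrev BoundaryCycle (D : Diagram X C R) : Type _ :=
  Quotient (Equiv.Perm.SameCycle.setoid (boundaryWalk D.glue))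

theorem component_glue (D : Diagram X C R) (d : X × Fin 4) :
    (Quotient.mk D.componentSetoid (D.glue d).1) = Quotient.mk D.componentSetoid d.1 :=
  Quotient.sound (Relation.EqvGen.symm _ _ (Relation.EqvGen.rel _ _ ⟨d.2, rfl⟩))

theorem eq_of_sameCycle {α β : Type*} {p : Equiv.Perm α} {f : α → β}
    (hf : ∀ a, f (p a) = f a) {a b : α} (h : p.SameCycle a b) : f a = f b := by
  obtain ⟨n, rfl⟩ := h
  have hz : ∀ (n : ℤ) a, f ((p ^ n) a) = f a := by
    intro n
    induction n with
    | zero => simp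
    | succ n ih => intro a; rw [zpow_add_one, Equiv.Perm.mul_apply, ih, hf]
    | pred n ih =>
      intro a
      have h := hf (p⁻¹ a)
      rw [show p (p⁻¹ a) = a from p.apply_symm_apply a] at h
      rw [zpow_sub_one, Equiv.Perm.mul_apply, ih, h]
  exact (hz n a).symm

/-- The region that contains a boundary cycle. -/
def cycleRegion (D : Diagram X C R) : D.BoundaryCycle → R :=
  Quotient.lift D.region fun _ _ h => eq_of_sameCycle D.region_boundaryWalk h

/-- The connected component of the diagram that contains a boundary cycle. -/
def cycleComponent (D : Diagram X C R) : D.BoundaryCycle → D.Component :=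
  Quotient.lift (fun d => Quotient.mk D.componentSetoid d.1)
    fun _ _ h => eq_of_sameCycle (p := boundaryWalk D.glue)
      (f := fun d => Quotient.mk D.componentSetoid d.1) D.component_glue h

/-- The coboundary map of the bipartite graph of the regions and the connected components of the
diagram, whose edges are the boundary cycles. -/
def incidence (D : Diagram X C R) :
    (R ⊕ (D.Component ⊕ C) → ZMod 2) →ₗ[ZMod 2] (D.BoundaryCycle ⊕ C × Bool → ZMod 2) where
  toFun f := Sum.elim
    (fun z => f (.inl (D.cycleRegion z)) + f (.inr (.inl (D.cycleComponent z))))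
    (fun kb => f (.inl (D.side kb.1 kb.2)) + f (.inr (.inr kb.1)))
  map_add' f g := by
    ext (z | z) <;> simp <;> ring
  map_smul' a f := by
    ext (z | z) <;> simp <;> ring

theorem eq_of_incidence_eq_zero (D : Diagram X C R) {f : R ⊕ (D.Component ⊕ C) → ZMod 2}
    (hf : D.incidence f = 0) (v w : R ⊕ (D.Component ⊕ C)) : f v = f w := by
  have hz (d : X × Fin 4) :
      f (.inl (D.region d)) = f (.inr (.inl (Quotient.mk D.componentSetoid d.1))) :=
    CharTwo.add_eq_zero.1 (congrFun hf (.inl (Quotient.mk _ d)))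
  have hk (k : C) (b : Bool) : f (.inl (D.side k b)) = f (.inr (.inr k)) :=
    CharTwo.add_eq_zero.1 (congrFun hf (.inr (k, b)))
  have hR : ∀ r r' : R, f (.inl r) = f (.inl r') := by
    refine D.eq_of_jump_eq_zero (f := fun r => f (.inl r)) (Prod.ext ?_ ?_)
    · funext d
      exact CharTwo.add_eq_zero.2 ((hz d).trans (hz (d.1, d.2 - 1)).symm)
    · funext k
      exact CharTwo.add_eq_zero.2 ((hk k false).trans (hk k true).symm)
  have key : ∀ v, f v = f (.inl D.dot) := by
    rintro (r | κ | k)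
    · exact hR _ _
    · induction κ using Quotient.inductionOn with
      | h x => exact (hz (x, 0)).symm.trans (hR _ _)
    · exact (hk k false).symm.trans (hR _ _)
  rw [key v, key w]

/-- The graph of regions and connected components is connected, so it has at least as many edges
as a tree. -/
theorem card_add_card_component_le (D : Diagram X C R) :
    Fintype.card R + Nat.card D.Component ≤
      Nat.card D.BoundaryCycle + Fintype.card C + 1 := by
  classical
  have : Fintype D.Component := Fintype.ofFinite _
  have : Fintype D.BoundaryCycle := Fintype.ofFinite _
  have h := LinearMap.finrank_range_add_finrank_ker D.incidence
  have hk := finrank_le_one_of_forall_eq (LinearMap.ker D.incidence)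
    fun f hf => D.eq_of_incidence_eq_zero (LinearMap.mem_ker.1 hf)
  have hr := Submodule.finrank_le (LinearMap.range D.incidence)
  rw [Module.finrank_fintype_fun_eq_card] at h hr
  simp only [Fintype.card_sum, Fintype.card_prod, Fintype.card_bool] at h hr
  rw [Nat.card_eq_fintype_card, Nat.card_eq_fintype_card]
  omega

/-! ### Cycles modulo two -/

/-- The functions modulo two on the edges. -/
def edgeFunctions (D : Diagram X C R) : Submodule (ZMod 2) (X × Fin 4 → ZMod 2) where
  carrier := {g | ∀ d, g (D.glue d) = g d}
  add_mem' hf hg d := by simp [hf d, hg d]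
  zero_mem' d := rfl
  smul_mem' a f hf d := by simp [hf d]

theorem finrank_edgeFunctions_le (D : Diagram X C R) :
    Module.finrank (ZMod 2) D.edgeFunctions ≤ 2 * Fintype.card X := by
  classical
  let e := Fintype.equivFin (X × Fin 4)
  -- An arbitrary ordering of the ends selects exactly one end of each edge, hence half of the `4
  -- |X|` ends.
  let P : X × Fin 4 → Prop := fun d => e d < e (D.glue d)
  have hP (d : X × Fin 4) : P (D.glue d) ↔ ¬ P d := by
    have hne : e (D.glue d) ≠ e d := fun h => D.glue_ne d (e.injective h)
    simp only [P, D.glue_glue, not_lt]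
    exact ⟨le_of_lt, fun h => lt_of_le_of_ne h hne⟩
  have hcard : Fintype.card {d // P d} = Fintype.card {d // ¬ P d} :=
    Fintype.card_congr
      { toFun := fun d => ⟨D.glue d, fun h => (hP _).1 h d.2⟩
        invFun := fun d => ⟨D.glue d, (hP _).2 d.2⟩
        left_inv := fun d => Subtype.ext (D.glue_glue d)
        right_inv := fun d => Subtype.ext (D.glue_glue d) }
  have hsum := Fintype.card_subtype_compl P
  have hle := Fintype.card_subtype_le P
  have hends : Fintype.card (X × Fin 4) = Fintype.card X * 4 := by
    rw [Fintype.card_prod, Fintype.card_fin]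
  let ρ : D.edgeFunctions →ₗ[ZMod 2] ({d // P d} → ZMod 2) :=
    (LinearMap.funLeft (ZMod 2) (ZMod 2) (Subtype.val : {d // P d} → X × Fin 4)).comp
      D.edgeFunctions.subtype
  have hρ : Function.Injective ρ := by
    intro g g' h
    ext d
    by_cases hd : P d
    · exact congrFun h ⟨d, hd⟩
    · rw [← g.2 d, ← g'.2 d]
      exact congrFun h ⟨D.glue d, (hP d).2 hd⟩
  have := LinearMap.finrank_le_finrank_of_injective hρ
  rw [Module.finrank_fintype_fun_eq_card] at this
  omega

/-- The sum over the four ends at each crossing. -/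
def crossingSum (D : Diagram X C R) : D.edgeFunctions →ₗ[ZMod 2] (X → ZMod 2) where
  toFun g x := ∑ i, g.1 (x, i)
  map_add' f g := by
    ext x; simp [Finset.sum_add_distrib]
  map_smul' a f := by
    ext x; simp [Finset.mul_sum]

/-- The boundary of a single edge is the sum of its two endpoints, so a functional that kills all
boundaries cannot distinguish them. The cokernel of the boundary map thus has at most one dimension
per component. -/
theorem dual_eq_of_mem_dualAnnihilator [DecidableEq X] (D : Diagram X C R)
    {φ : Module.Dual (ZMod 2) (X → ZMod 2)}
    (hφ : φ ∈ (LinearMap.range D.crossingSum).dualAnnihilator) {x y : X}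
    (h : D.componentSetoid x y) : φ (Pi.single x 1) = φ (Pi.single y 1) := by
  induction h with
  | rel x y h =>
    obtain ⟨i, rfl⟩ := h
    let d : X × Fin 4 := (x, i)
    let g : X × Fin 4 → ZMod 2 := Pi.single d 1 + Pi.single (D.glue d) 1
    have hg : g ∈ D.edgeFunctions := by
      intro e
      have h₁ : D.glue e = d ↔ e = D.glue d :=
        ⟨fun h => by rw [← h, D.glue_glue], fun h => by rw [h, D.glue_glue]⟩
      simp only [g, Pi.add_apply, Pi.single_apply, h₁, D.glue.injective.eq_iff]
      exact add_comm _ _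
    have hs : D.crossingSum ⟨g, hg⟩ = Pi.single x 1 + Pi.single (D.glue d).1 1 := by
      have key (d : X × Fin 4) (z : X) :
          ∑ i, (Pi.single d 1 : X × Fin 4 → ZMod 2) (z, i) =
            Pi.single (M := fun _ => ZMod 2) d.1 1 z := by
        simp only [Pi.single_apply, Prod.ext_iff]
        by_cases hz : z = d.1 <;> simp [hz]
      ext z
      change ∑ i, (Pi.single d 1 + Pi.single (D.glue d) 1 : X × Fin 4 → ZMod 2) (z, i) = _
      simp only [Pi.add_apply, Finset.sum_add_distrib, key]
      rfl
    have := (Submodule.mem_dualAnnihilator φ).1 hφ _ (LinearMap.mem_range_self _ ⟨g, hg⟩)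
    rw [hs, map_add] at this
    exact CharTwo.add_eq_zero.1 this
  | refl => rfl
  | symm _ _ _ ih => exact ih.symm
  | trans _ _ _ _ _ ih₁ ih₂ => exact ih₁.trans ih₂

theorem finrank_dualAnnihilator_range_crossingSum_le (D : Diagram X C R) :
    Module.finrank (ZMod 2) (LinearMap.range D.crossingSum).dualAnnihilator ≤
      Nat.card D.Component := by
  classical
  have : Fintype D.Component := Fintype.ofFinite _
  let ρ : (LinearMap.range D.crossingSum).dualAnnihilator →ₗ[ZMod 2] (D.Component → ZMod 2) :=
    { toFun := fun φ κ => φ.1 (Pi.single κ.out 1)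
      map_add' := fun _ _ => rfl
      map_smul' := fun _ _ => rfl }
  have hρ : Function.Injective ρ := by
    intro φ ψ h
    ext x
    have hx := Quotient.exact (Quotient.out_eq (Quotient.mk D.componentSetoid x))
    have := congrFun h (Quotient.mk D.componentSetoid x)
    change φ.1 (Pi.single x 1) = ψ.1 (Pi.single x 1)
    rw [← D.dual_eq_of_mem_dualAnnihilator φ.2 hx, ← D.dual_eq_of_mem_dualAnnihilator ψ.2 hx]
    exact this
  have := LinearMap.finrank_le_finrank_of_injective hρ
  rwa [Module.finrank_fintype_fun_eq_card, ← Nat.card_eq_fintype_card] at this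

theorem finrank_ker_crossingSum_le (D : Diagram X C R) :
    Module.finrank (ZMod 2) (LinearMap.ker D.crossingSum) ≤
      Fintype.card X + Nat.card D.Component := by
  have h₁ := D.finrank_edgeFunctions_le
  have h₂ := LinearMap.finrank_range_add_finrank_ker D.crossingSum
  have h₃ := Subspace.finrank_add_finrank_dualAnnihilator_eq (LinearMap.range D.crossingSum)
  have h₄ := D.finrank_dualAnnihilator_range_crossingSum_le
  rw [Module.finrank_fintype_fun_eq_card] at h₃
  omega

/-- Every cycle modulo two on the sphere bounds: it is the set of edges and components without
crossings where a function on the regions jumps. -/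
theorem exists_jump_eq (D : Diagram X C R) (g : X × Fin 4 → ZMod 2) (h : C → ZMod 2)
    (hg : ∀ d, g (D.glue d) = g d) (hsum : ∀ x, ∑ i, g (x, i) = 0) :
    ∃ f, D.jump f = (g, h) := by
  classical
  let Z := LinearMap.range ((D.edgeFunctions.subtype.comp
    (LinearMap.ker D.crossingSum).subtype).prodMap
      (LinearMap.id : (C → ZMod 2) →ₗ[ZMod 2] (C → ZMod 2)))
  have hle : LinearMap.range D.jump ≤ Z := by
    rintro _ ⟨f, rfl⟩
    refine ⟨(⟨⟨(D.jump f).1, fun d => ?_⟩, ?_⟩, (D.jump f).2), rfl⟩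
    · change f (D.region (D.glue d)) + f (D.rightRegion (D.glue d)) =
        f (D.region d) + f (D.rightRegion d)
      rw [D.region_glue, D.rightRegion_glue, add_comm]
    · refine LinearMap.mem_ker.2 (funext fun x => ?_)
      change ∑ i, (f (D.region (x, i)) + f (D.region (x, i - 1))) = 0
      rw [Finset.sum_add_distrib, CharTwo.add_eq_zero]
      exact (Equiv.sum_comp (Equiv.subRight (1 : Fin 4)) fun i => f (D.region (x, i))).symm
  have hZ : Module.finrank (ZMod 2) Z ≤
      Fintype.card X + Nat.card D.Component + Fintype.card C := by
    refine (LinearMap.finrank_range_le _).trans ?_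
    rw [Module.finrank_prod, Module.finrank_fintype_fun_eq_card]
    exact Nat.add_le_add_right D.finrank_ker_crossingSum_le _
  -- With `K` components and `Z'` boundary cycles, the rank of `jump` is at least `|R| - 1`. Euler's
  -- formula gives `2|R| = |X| + Z' + 2|C| + 2`; subtracting `|R| + K ≤ Z' + |C| + 1` leaves `|R| -
  -- 1 ≥ |X| + K + |C|`, the upper bound for the dimension of the cycle space.
  have hrank : Module.finrank (ZMod 2) Z ≤
      Module.finrank (ZMod 2) (LinearMap.range D.jump) := by
    have h₁ := D.card_le_finrank_range_jump
    have h₂ := D.card_add_card_component_le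
    have h₃ := D.euler
    change _ = _ + (Nat.card D.BoundaryCycle + _) + _ at h₃
    omega
  have heq := Submodule.eq_of_le_of_finrank_le hle hrank
  have hmem : (g, h) ∈ Z :=
    ⟨(⟨⟨g, hg⟩, LinearMap.mem_ker.2 (funext hsum)⟩, h), rfl⟩
  rw [← heq] at hmem
  exact hmem

end Diagram

end SolidTorus

/-! ### Separation by state circles and winding numbers modulo two. -/

namespace SolidTorus

namespace Diagram

variable {X C R : Type*} [Fintype X] [Fintype C] [Fintype R]

/-! ### State circles as cycles modulo two -/

theorem circleOf_glue (D : Diagram X C R) (s : X → Smoothing) (d : X × Fin 4) :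
    D.circleOf s (D.glue d) = D.circleOf s d :=
  congrArg Sum.inl (Quotient.sound
    (Relation.EqvGen.symm _ _ (Relation.EqvGen.rel _ _ (Or.inl rfl))))

theorem circleOf_join (D : Diagram X C R) (s : X → Smoothing) (x : X) (i : Fin 4) :
    D.circleOf s (x, (s x).join i) = D.circleOf s (x, i) :=
  congrArg Sum.inl (Quotient.sound
    (Relation.EqvGen.symm _ _ (Relation.EqvGen.rel _ _ (Or.inr rfl))))

theorem circleOf_eq_iff (D : Diagram X C R) (s : X → Smoothing) (d e : X × Fin 4) :
    D.circleOf s d = D.circleOf s e ↔ D.circleSetoid s d e :=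
  ⟨fun h => Quotient.exact (Sum.inl_injective h), fun h => congrArg Sum.inl (Quotient.sound h)⟩

open Classical in
/-- The edges and components without crossings that belong to a state circle. -/
noncomputable def circleIndicator (D : Diagram X C R) (s : X → Smoothing) (γ : D.Circle s) :
    (X × Fin 4 → ZMod 2) × (C → ZMod 2) :=
  (fun d => if D.circleOf s d = γ then 1 else 0, fun k => if Sum.inr k = γ then 1 else 0)

/-- Every state circle separates the sphere. -/
theorem exists_jump_eq_circleIndicator (D : Diagram X C R) (s : X → Smoothing) (γ : D.Circle s) :
    ∃ f, D.jump f = D.circleIndicator s γ := by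
  classical
  refine D.exists_jump_eq _ _ (fun d => ?_) fun x => ?_
  · rw [circleOf_glue]
  -- The smoothing pairs the four ends, and both ends of a pair lie on the same circle, so the
  -- circle contains an even number of them.
  · have h₀ := D.circleOf_join s x 0
    have h₁ := D.circleOf_join s x 1
    have h₂ := D.circleOf_join s x 2
    rw [Fin.sum_univ_four]
    cases hs : s x <;> rw [hs] at h₀ h₁ h₂
    · change D.circleOf s (x, 1) = _ at h₀
      change D.circleOf s (x, 3) = _ at h₂
      rw [h₀, h₂, CharTwo.add_self_eq_zero, zero_add, CharTwo.add_self_eq_zero]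
    · change D.circleOf s (x, 3) = _ at h₀
      change D.circleOf s (x, 2) = _ at h₁
      rw [h₀, h₁, add_assoc, add_assoc, ← add_assoc _ _ (ite (D.circleOf s (x, 0) = γ) _ _),
        CharTwo.add_self_eq_zero, zero_add, CharTwo.add_self_eq_zero]

/-- Functions with the same jumps distinguish the same regions. -/
theorem add_eq_add_of_jump_eq (D : Diagram X C R) {f f' : R → ZMod 2}
    (h : D.jump f = D.jump f') (r r' : R) : f r + f r' = f' r + f' r' := by
  have := D.eq_of_jump_eq_zero (f := f + f') (by
    rw [map_add, h]
    ext <;> exact CharTwo.add_self_eq_zero _) r r'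
  simp only [Pi.add_apply] at this
  rw [← CharTwo.add_eq_zero] at this ⊢
  rw [← this]
  ring

theorem jump_ne_iff (D : Diagram X C R) {s : X → Smoothing} {γ : D.Circle s} {f : R → ZMod 2}
    (hf : D.jump f = D.circleIndicator s γ) (d : X × Fin 4) :
    f (D.region d) ≠ f (D.rightRegion d) ↔ D.circleOf s d = γ := by
  have h : f (D.region d) + f (D.rightRegion d) = _ := congrFun (congrArg Prod.fst hf) d
  rw [Ne, ← CharTwo.add_eq_zero, h]
  simp [circleIndicator]

theorem jump_side_ne_iff (D : Diagram X C R) {s : X → Smoothing} {γ : D.Circle s}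
    {f : R → ZMod 2} (hf : D.jump f = D.circleIndicator s γ) (k : C) :
    f (D.side k false) ≠ f (D.side k true) ↔ Sum.inr k = γ := by
  have h : f (D.side k false) + f (D.side k true) = _ := congrFun (congrArg Prod.snd hf) k
  rw [Ne, ← CharTwo.add_eq_zero, h]
  simp [circleIndicator]

theorem eq_of_ne_of_ne {a b c : ZMod 2} (hab : a ≠ b) (hbc : b ≠ c) : a = c := by
  revert a b c; decide

/-- Between the two merged corners one crosses two ends that the smoothing joins. Either both lie on
`γ` and the two jumps cancel, or neither does. -/
theorem apply_opened (D : Diagram X C R) {s : X → Smoothing} {γ : D.Circle s} {f : R → ZMod 2}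
    (hf : D.jump f = D.circleIndicator s γ) (x : X) :
    f (D.region (x, (s x).opened)) = f (D.region (x, (s x).opened + 2)) := by
  have key (i : Fin 4) (hi : D.circleOf s (x, i + 2) = D.circleOf s (x, i + 1)) :
      f (D.region (x, i)) = f (D.region (x, i + 2)) := by
    have h₁ := D.jump_ne_iff hf (x, i + 1)
    have h₂ := D.jump_ne_iff hf (x, i + 2)
    rw [hi] at h₂
    simp only [rightRegion, add_sub_cancel_right] at h₁ h₂
    rw [show i + 2 - 1 = i + 1 by clear hi h₁ h₂; revert i; decide] at h₂
    by_cases hγ : D.circleOf s (x, i + 1) = γ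
    · exact eq_of_ne_of_ne (h₁.2 hγ).symm (h₂.2 hγ).symm
    · rw [← h₁] at hγ
      rw [← h₁] at h₂
      simp only [not_not] at hγ
      rw [← hγ]
      by_contra hne
      exact h₂.1 (Ne.symm (hγ ▸ hne)) hγ
  apply key
  cases hs : s x
  · have h := D.circleOf_join s x 2
    rw [hs] at h
    exact h
  · have h := D.circleOf_join s x 1
    rw [hs] at h
    exact h

theorem apply_eq_of_step (D : Diagram X C R) {s : X → Smoothing} {γ : D.Circle s}
    {f : R → ZMod 2} (hf : D.jump f = D.circleIndicator s γ) {r r' : R}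
    (h : Relation.EqvGen (D.Step s γ) r r') : f r = f r' := by
  induction h with
  | rel p q h =>
    cases h with
    | edge x i h => exact not_not.1 fun hne => h ((D.jump_ne_iff hf (x, i)).1 hne)
    | circle k h => exact not_not.1 fun hne => h ((D.jump_side_ne_iff hf k).1 hne)
    | opened x => exact D.apply_opened hf x
  | refl => rfl
  | symm _ _ _ ih => exact ih.symm
  | trans _ _ _ _ _ ih₁ ih₂ => exact ih₁.trans ih₂

/-! ### A state circle has only two sides -/

/-- The regions on the two sides of an edge are on the two sides `p`, `q` of a state circle. -/
def OnSides (D : Diagram X C R) (s : X → Smoothing) (γ : D.Circle s) (p q a b : R) : Prop :=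
  (Relation.EqvGen (D.Step s γ) a p ∧ Relation.EqvGen (D.Step s γ) b q) ∨
    (Relation.EqvGen (D.Step s γ) a q ∧ Relation.EqvGen (D.Step s γ) b p)

theorem OnSides.trans {D : Diagram X C R} {s : X → Smoothing} {γ : D.Circle s}
    {p q a b a' b' : R} (h : D.OnSides s γ a b a' b') (h' : D.OnSides s γ p q a b) :
    D.OnSides s γ p q a' b' := by
  rcases h with ⟨h₁, h₂⟩ | ⟨h₁, h₂⟩ <;> rcases h' with ⟨h₃, h₄⟩ | ⟨h₃, h₄⟩
  · exact .inl ⟨h₁.trans _ _ _ h₃, h₂.trans _ _ _ h₄⟩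
  · exact .inr ⟨h₁.trans _ _ _ h₃, h₂.trans _ _ _ h₄⟩
  · exact .inr ⟨h₁.trans _ _ _ h₄, h₂.trans _ _ _ h₃⟩
  · exact .inl ⟨h₁.trans _ _ _ h₄, h₂.trans _ _ _ h₃⟩

theorem OnSides.symm {D : Diagram X C R} {s : X → Smoothing} {γ : D.Circle s}
    {p q a b : R} (h : D.OnSides s γ p q a b) : D.OnSides s γ a b p q := by
  rcases h with ⟨h₁, h₂⟩ | ⟨h₁, h₂⟩
  · exact .inl ⟨h₁.symm _ _, h₂.symm _ _⟩
  · exact .inr ⟨h₂.symm _ _, h₁.symm _ _⟩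

/-- Following a circle one stays between the same two sides. -/
theorem onSides_of_circleSetoid (D : Diagram X C R) {s : X → Smoothing} (γ : D.Circle s)
    {d e : X × Fin 4} (h : D.circleSetoid s d e) :
    D.OnSides s γ (D.region d) (D.rightRegion d) (D.region e) (D.rightRegion e) := by
  induction h with
  | rel d e h =>
    rcases h with rfl | rfl
    · rw [D.region_glue, D.rightRegion_glue]
      exact .inr ⟨.refl _, .refl _⟩
    · obtain ⟨x, i⟩ := d
      have ho := Relation.EqvGen.rel _ _ (Step.opened (D := D) (s := s) (γ := γ) x)
      simp only [rightRegion]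
      cases hs : s x <;> rw [hs] at ho
      · change Relation.EqvGen _ (D.region (x, 1)) (D.region (x, 3)) at ho
        fin_cases i
        · exact .inr ⟨ho, .refl _⟩
        · exact .inr ⟨.refl _, ho.symm _ _⟩
        · exact .inr ⟨ho.symm _ _, .refl _⟩
        · exact .inr ⟨.refl _, ho⟩
      · change Relation.EqvGen _ (D.region (x, 0)) (D.region (x, 2)) at ho
        fin_cases i
        · exact .inr ⟨.refl _, ho.symm _ _⟩
        · exact .inr ⟨ho.symm _ _, .refl _⟩
        · exact .inr ⟨.refl _, ho⟩
        · exact .inr ⟨ho, .refl _⟩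
  | refl => exact .inl ⟨.refl _, .refl _⟩
  | symm _ _ _ ih => exact ih.symm
  | trans _ _ _ _ _ ih₁ ih₂ => exact ih₂.trans ih₁

/-- Every region lies on one of the two sides of a state circle. -/
theorem exists_sides (D : Diagram X C R) {s : X → Smoothing} {γ : D.Circle s}
    {f : R → ZMod 2} (hf : D.jump f = D.circleIndicator s γ) :
    ∃ p q, f p ≠ f q ∧
      ∀ r, Relation.EqvGen (D.Step s γ) r p ∨ Relation.EqvGen (D.Step s γ) r q := by
  obtain ⟨p, q, hpq, hedge, hcircle⟩ : ∃ p q, f p ≠ f q ∧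
      (∀ d, D.circleOf s d = γ → D.OnSides s γ p q (D.region d) (D.rightRegion d)) ∧
      ∀ k, Sum.inr k = γ → D.OnSides s γ p q (D.side k false) (D.side k true) := by
    rcases hγ : γ with z | k
    · induction z using Quotient.inductionOn with
      | h e =>
        refine ⟨D.region e, D.rightRegion e, (D.jump_ne_iff hf e).2 hγ.symm, fun d hd => ?_,
          fun k hk => nomatch hk⟩
        exact D.onSides_of_circleSetoid _ ((D.circleOf_eq_iff s e d).1 hd.symm)
    · refine ⟨D.side k false, D.side k true, (D.jump_side_ne_iff hf k).2 hγ.symm,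
        (fun d hd => nomatch hd), fun k' hk => ?_⟩
      cases hk
      exact .inl ⟨.refl _, .refl _⟩
  refine ⟨p, q, hpq, fun r => ?_⟩
  have hmem {a b : R} (h : D.OnSides s γ p q a b) :
      (Relation.EqvGen (D.Step s γ) a p ∨ Relation.EqvGen (D.Step s γ) a q) ↔
      (Relation.EqvGen (D.Step s γ) b p ∨ Relation.EqvGen (D.Step s γ) b q) := by
    rcases h with h | h <;> simp [h.1, h.2]
  have hstep {a b : R} (h : D.Step s γ a b) :
      (Relation.EqvGen (D.Step s γ) a p ∨ Relation.EqvGen (D.Step s γ) a q) ↔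
      (Relation.EqvGen (D.Step s γ) b p ∨ Relation.EqvGen (D.Step s γ) b q) := by
    have h' := Relation.EqvGen.rel _ _ h
    exact or_congr ⟨fun h => (h'.symm _ _).trans _ _ _ h, fun h => h'.trans _ _ _ h⟩
      ⟨fun h => (h'.symm _ _).trans _ _ _ h, fun h => h'.trans _ _ _ h⟩
  have key {a b : R} (h : Relation.EqvGen
    (fun p q => (∃ x i, p = D.region (x, i) ∧ q = D.region (x, i - 1)) ∨
      (∃ k, p = D.side k false ∧ q = D.side k true)) a b) :
      (Relation.EqvGen (D.Step s γ) a p ∨ Relation.EqvGen (D.Step s γ) a q) ↔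
      (Relation.EqvGen (D.Step s γ) b p ∨ Relation.EqvGen (D.Step s γ) b q) := by
    induction h with
    | rel a b h =>
      rcases h with ⟨x, i, rfl, rfl⟩ | ⟨k, rfl, rfl⟩
      · by_cases hγ : D.circleOf s (x, i) = γ
        · exact hmem (hedge _ hγ)
        · exact hstep (.edge x i hγ)
      · by_cases hγ : Sum.inr k = γ
        · exact hmem (hcircle k hγ)
        · exact hstep (.circle k hγ)
    | refl => exact Iff.rfl
    | symm _ _ _ ih => exact ih.symm
    | trans _ _ _ _ _ ih₁ ih₂ => exact ih₁.trans ih₂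
  exact (key (D.connected r p)).2 (.inl (.refl _))

/-- Paths that avoid `γ` preserve `f`. Conversely, the complement of `γ` has only two sides, on
which `f` differs, so equal values force the same side. -/
theorem aroundDot_iff (D : Diagram X C R) {s : X → Smoothing} {γ : D.Circle s}
    {f : R → ZMod 2} (hf : D.jump f = D.circleIndicator s γ) :
    D.AroundDot s γ ↔ f D.dot ≠ f D.outer := by
  refine ⟨fun h heq => h ?_, fun h h' => h (D.apply_eq_of_step hf h')⟩
  obtain ⟨p, q, hpq, hall⟩ := D.exists_sides hf
  rcases hall D.dot with h₁ | h₁ <;> rcases hall D.outer with h₂ | h₂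
  · exact h₁.trans _ _ _ (h₂.symm _ _)
  · exact absurd ((D.apply_eq_of_step hf h₁).symm.trans
      (heq.trans (D.apply_eq_of_step hf h₂))) hpq
  · exact absurd ((D.apply_eq_of_step hf h₂).symm.trans
      (heq.symm.trans (D.apply_eq_of_step hf h₁))) hpq
  · exact h₁.trans _ _ _ (h₂.symm _ _)

/-! ### Winding numbers modulo two -/

/-- The winding number modulo two of a state circle around the dot. -/
noncomputable def winding (D : Diagram X C R) (s : X → Smoothing) (γ : D.Circle s) : ZMod 2 :=
  (D.exists_jump_eq_circleIndicator s γ).choose D.dot +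
    (D.exists_jump_eq_circleIndicator s γ).choose D.outer

theorem aroundDot_iff_winding (D : Diagram X C R) (s : X → Smoothing) (γ : D.Circle s) :
    D.AroundDot s γ ↔ D.winding s γ ≠ 0 := by
  rw [D.aroundDot_iff (D.exists_jump_eq_circleIndicator s γ).choose_spec, winding, Ne,
    ← CharTwo.add_eq_zero]

/-- The winding number does not depend on the chosen bounding function, since two choices differ by
a constant. -/
theorem winding_eq (D : Diagram X C R) {s : X → Smoothing} {γ : D.Circle s}
    {f : R → ZMod 2} (hf : D.jump f = D.circleIndicator s γ) :
    D.winding s γ = f D.dot + f D.outer :=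
  D.add_eq_add_of_jump_eq ((D.exists_jump_eq_circleIndicator s γ).choose_spec.trans hf.symm) _ _

/-- If a state circle is the sum modulo two of circles of another state, then so are the winding
numbers. -/
theorem winding_eq_sum (D : Diagram X C R) {s s' : X → Smoothing} (γ : D.Circle s)
    (G : Finset (D.Circle s'))
    (h : D.circleIndicator s γ = ∑ γ' ∈ G, D.circleIndicator s' γ') :
    D.winding s γ = ∑ γ' ∈ G, D.winding s' γ' := by
  have hf : D.jump (∑ γ' ∈ G, (D.exists_jump_eq_circleIndicator s' γ').choose) =
      D.circleIndicator s γ := by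
    rw [map_sum, h]
    exact Finset.sum_congr rfl fun γ' _ => (D.exists_jump_eq_circleIndicator s' γ').choose_spec
  rw [D.winding_eq hf]
  simp only [Finset.sum_apply, winding, Finset.sum_add_distrib]

/-- The map on circles if the circles of `s'` are contained in those of `s`. -/
def coarsen (D : Diagram X C R) {s s' : X → Smoothing}
    (h : D.circleSetoid s' ≤ D.circleSetoid s) : D.Circle s' → D.Circle s :=
  Sum.map (Quotient.map id fun _ _ hab => h hab) id

theorem coarsen_circleOf (D : Diagram X C R) {s s' : X → Smoothing}
    (h : D.circleSetoid s' ≤ D.circleSetoid s) (d : X × Fin 4) :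
    D.coarsen h (D.circleOf s' d) = D.circleOf s d :=
  rfl

-- Each circle of the coarser state is, as a set of edges and components without crossings, the
-- disjoint union of the finer circles that map to it.
open Classical in
theorem winding_eq_sum_coarsen (D : Diagram X C R) {s s' : X → Smoothing}
    (h : D.circleSetoid s' ≤ D.circleSetoid s) [Fintype (D.Circle s')] (γ : D.Circle s) :
    D.winding s γ = ∑ γ' with D.coarsen h γ' = γ, D.winding s' γ' := by
  refine D.winding_eq_sum γ _ (Prod.ext ?_ ?_)
  · funext d
    rw [Prod.fst_sum, Finset.sum_apply]
    simp only [circleIndicator, Finset.sum_ite_eq, Finset.mem_filter, Finset.mem_univ, true_and,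
      coarsen_circleOf]
  · funext k
    rw [Prod.snd_sum, Finset.sum_apply]
    simp only [circleIndicator, Finset.sum_ite_eq, Finset.mem_filter, Finset.mem_univ, true_and]
    rfl

end Diagram

end SolidTorus

/-! ### How the number of circles varies with the smoothings. -/

namespace SolidTorus

namespace Diagram

variable {X C R : Type*} [Fintype X] [Fintype C] [Fintype R]

/-! ### Changing the smoothing of one crossing -/

/-- The end `d` lies on a circle of the state `s` that comes close to the crossing `x`. -/
def Touches (D : Diagram X C R) (s : X → Smoothing) (x : X) (d : X × Fin 4) : Prop :=
  D.circleSetoid s d (x, 0) ∨ D.circleSetoid s d (x, 2)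

theorem circleSetoid_join (D : Diagram X C R) (s : X → Smoothing) (x : X) (i : Fin 4) :
    D.circleSetoid s (x, i) (x, (s x).join i) :=
  Relation.EqvGen.rel _ _ (Or.inr rfl)

theorem _root_.SolidTorus.Smoothing.join_cover (σ : Smoothing) (i j : Fin 4) :
    (i = j ∨ i = j + 2) ∨ σ.join i = j ∨ σ.join i = j + 2 := by
  revert σ i j; decide

/-- At every crossing, two opposite ends meet all the circles there. -/
theorem circleSetoid_or_circleSetoid_opposite (D : Diagram X C R) (s : X → Smoothing) (x : X)
    (i j : Fin 4) :
    D.circleSetoid s (x, i) (x, j) ∨ D.circleSetoid s (x, i) (x, j + 2) := by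
  have h := D.circleSetoid_join s x i
  rcases (s x).join_cover i j with (rfl | rfl) | hj | hj
  · exact .inl ((D.circleSetoid s).refl _)
  · exact .inr ((D.circleSetoid s).refl _)
  · rw [hj] at h; exact .inl h
  · rw [hj] at h; exact .inr h

theorem touches_end (D : Diagram X C R) (s : X → Smoothing) (x : X) (i : Fin 4) :
    D.Touches s x (x, i) :=
  D.circleSetoid_or_circleSetoid_opposite s x i 0

theorem Touches.of_circleSetoid {D : Diagram X C R} {s : X → Smoothing} {x : X}
    {d e : X × Fin 4} (h : D.Touches s x e) (hde : D.circleSetoid s d e) : D.Touches s x d :=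
  h.imp (fun h => (D.circleSetoid s).trans hde h) fun h => (D.circleSetoid s).trans hde h

/-- The state circles after all those that come close to the crossing `x` have been merged. -/
def mergedSetoid (D : Diagram X C R) (s : X → Smoothing) (x : X) : Setoid (X × Fin 4) where
  r d e := D.circleSetoid s d e ∨ (D.Touches s x d ∧ D.Touches s x e)
  iseqv :=
    { refl := fun d => .inl ((D.circleSetoid s).refl d)
      symm := fun h => h.imp (fun h => (D.circleSetoid s).symm h) And.symm
      trans := by
        rintro a b c (h | h) (h' | h')
        · exact .inl ((D.circleSetoid s).trans h h')
        · exact .inr ⟨h'.1.of_circleSetoid h, h'.2⟩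
        · exact .inr ⟨h.1, h.2.of_circleSetoid ((D.circleSetoid s).symm h')⟩
        · exact .inr ⟨h.1, h'.2⟩ }

/-- Once all ends at `x` are identified, the smoothing there is irrelevant. The merged partition is
thus a common coarsening for comparing `s` and `s'`. -/
theorem circleSetoid_le_mergedSetoid (D : Diagram X C R) {s s' : X → Smoothing} {x : X}
    (h : ∀ y, y ≠ x → s' y = s y) : D.circleSetoid s' ≤ D.mergedSetoid s x := by
  intro d e hde
  induction hde with
  | rel d e hde =>
    rcases hde with rfl | rfl
    · exact .inl (Relation.EqvGen.rel _ _ (.inl rfl))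
    · by_cases hx : d.1 = x
      · obtain ⟨y, i⟩ := d
        cases hx
        exact .inr ⟨D.touches_end s _ _, D.touches_end s _ _⟩
      · rw [h _ hx]
        exact .inl (Relation.EqvGen.rel _ _ (.inr rfl))
  | refl d => exact Setoid.refl' _ d
  | symm _ _ _ ih => exact Setoid.symm' _ ih
  | trans _ _ _ _ _ ih₁ ih₂ => exact Setoid.trans' _ ih₁ ih₂

theorem card_quotient_le_of_le {α : Type*} [Finite α] {r r' : Setoid α} (h : r ≤ r') :
    Nat.card (Quotient r') ≤ Nat.card (Quotient r) :=
  Nat.card_le_card_of_surjective (Quotient.map id fun _ _ hab => h hab) fun q => by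
    induction q using Quotient.inductionOn with
    | h a => exact ⟨Quotient.mk r a, rfl⟩

theorem le_of_card_quotient_eq {α : Type*} [Finite α] {r r' : Setoid α} (h : r ≤ r')
    (hcard : Nat.card (Quotient r) ≤ Nat.card (Quotient r')) : r' ≤ r := by
  let φ : Quotient r → Quotient r' := Quotient.map id fun _ _ hab => h hab
  have hφ : Function.Surjective φ := fun q => by
    induction q using Quotient.inductionOn with
    | h a => exact ⟨Quotient.mk r a, rfl⟩
  have hinj := (Function.Surjective.bijective_of_nat_card_le hφ hcard).1
  intro a b hab
  exact Quotient.exact (hinj (a₁ := Quotient.mk r a) (a₂ := Quotient.mk r b) (Quotient.sound hab))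

theorem card_quotient_circleSetoid_le_mergedSetoid (D : Diagram X C R) (s : X → Smoothing)
    (x : X) :
    Nat.card (Quotient (D.circleSetoid s)) ≤ Nat.card (Quotient (D.mergedSetoid s x)) + 1 := by
  classical
  let π : Quotient (D.circleSetoid s) → Quotient (D.mergedSetoid s x) :=
    Quotient.map id fun _ _ h => .inl h
  -- At most two circles come close to `x`, those through the ends `0` and `2`. Once the first is
  -- set aside as `none`, merging identifies no others.
  let φ : Quotient (D.circleSetoid s) → Option (Quotient (D.mergedSetoid s x)) := fun q =>
    if q = Quotient.mk _ (x, 0) then none else some (π q)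
  have hφ : Function.Injective φ := by
    intro q q' h
    by_cases hq : q = Quotient.mk _ (x, 0) <;> by_cases hq' : q' = Quotient.mk _ (x, 0)
    · rw [hq, hq']
    · simp [φ, hq, hq'] at h
    · simp [φ, hq, hq'] at h
    · simp only [φ, hq, hq', if_false, Option.some.injEq] at h
      induction q using Quotient.inductionOn with | h d => ?_
      induction q' using Quotient.inductionOn with | h e => ?_
      rcases Quotient.exact h with h | ⟨h₁, h₂⟩
      · exact Quotient.sound h
      · have h₁' := h₁.resolve_left fun h => hq (Quotient.sound h)
        have h₂' := h₂.resolve_left fun h => hq' (Quotient.sound h)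
        exact Quotient.sound ((D.circleSetoid s).trans h₁' ((D.circleSetoid s).symm h₂'))
  have := Nat.card_le_card_of_injective φ hφ
  rwa [Finite.card_option] at this

/-- Opposite ends meet all circles near `x`; if they share a circle, it is the only one there and
merging changes nothing. -/
theorem mergedSetoid_le_of_opposite (D : Diagram X C R) {s : X → Smoothing} {x : X} {i : Fin 4}
    (h : D.circleSetoid s (x, i) (x, i + 2)) : D.mergedSetoid s x ≤ D.circleSetoid s := by
  have hend (j : Fin 4) : D.circleSetoid s (x, j) (x, i) :=
    (D.circleSetoid_or_circleSetoid_opposite s x j i).elim id fun hj =>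
      (D.circleSetoid s).trans hj ((D.circleSetoid s).symm h)
  have key {d : X × Fin 4} (hd : D.Touches s x d) : D.circleSetoid s d (x, i) :=
    hd.elim (fun h => (D.circleSetoid s).trans h (hend 0))
      fun h => (D.circleSetoid s).trans h (hend 2)
  rintro d e (hde | ⟨hd, he⟩)
  · exact hde
  · exact (D.circleSetoid s).trans (key hd) ((D.circleSetoid s).symm (key he))

theorem numCircles_eq (D : Diagram X C R) (s : X → Smoothing) :
    D.numCircles s = Nat.card (Quotient (D.circleSetoid s)) + Fintype.card C := by
  rw [numCircles, Nat.card_sum, Nat.card_eq_fintype_card (α := C)]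

/-- Changing one smoothing creates at most one circle. -/
theorem numCircles_le_add_one (D : Diagram X C R) {s s' : X → Smoothing} {x : X}
    (h : ∀ y, y ≠ x → s y = s' y) : D.numCircles s' ≤ D.numCircles s + 1 := by
  have h₁ := D.card_quotient_circleSetoid_le_mergedSetoid s' x
  have h₂ := card_quotient_le_of_le (D.circleSetoid_le_mergedSetoid h)
  rw [numCircles_eq, numCircles_eq]
  omega

/-- If a changed smoothing creates a circle, then it cuts a circle in two. -/
theorem circleSetoid_le_of_numCircles_eq (D : Diagram X C R) {s s' : X → Smoothing} {x : X}
    (h : ∀ y, y ≠ x → s y = s' y) (hcard : D.numCircles s' = D.numCircles s + 1) :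
    D.circleSetoid s' ≤ D.circleSetoid s := by
  have h₁ := D.card_quotient_circleSetoid_le_mergedSetoid s' x
  rw [numCircles_eq, numCircles_eq] at hcard
  -- The count leaves no room: the circles of `s` are exactly those of `s'` after merging at `x`.
  have hle := le_of_card_quotient_eq (D.circleSetoid_le_mergedSetoid h) (by omega)
  exact fun d e hde => hle (.inl hde)

theorem not_circleSetoid_of_numCircles_eq (D : Diagram X C R) {s s' : X → Smoothing} {x : X}
    (h : ∀ y, y ≠ x → s y = s' y) (hcard : D.numCircles s' = D.numCircles s + 1) (i : Fin 4) :
    ¬ D.circleSetoid s' (x, i) (x, i + 2) := by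
  intro hi
  have h₁ := card_quotient_le_of_le (D.mergedSetoid_le_of_opposite hi)
  have h₂ := card_quotient_le_of_le (D.circleSetoid_le_mergedSetoid h)
  rw [numCircles_eq, numCircles_eq] at hcard
  omega

/-! ### Changing several smoothings -/

/-- The state `s` with the smoothings at the crossings in `U` replaced by those of `s'`. -/
def mix {Y : Type*} [DecidableEq Y] (s s' : Y → Smoothing) (U : Finset Y) : Y → Smoothing :=
  fun x => if x ∈ U then s' x else s x

theorem mix_empty {Y : Type*} [DecidableEq Y] (s s' : Y → Smoothing) : mix s s' ∅ = s := by
  funext x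
  simp [mix]

theorem mix_insert_apply {Y : Type*} [DecidableEq Y] (s s' : Y → Smoothing) (U : Finset Y)
    (x y : Y) (h : y ≠ x) : mix s s' U y = mix s s' (insert x U) y := by
  simp [mix, h]

variable [DecidableEq X]

theorem numCircles_mix_le (D : Diagram X C R) (s s' : X → Smoothing) (U : Finset X) :
    D.numCircles (mix s s' U) ≤ D.numCircles s + U.card := by
  induction U using Finset.induction_on with
  | empty => simp [mix_empty]
  | insert x U hx ih =>
    have := D.numCircles_le_add_one (mix_insert_apply s s' U x)
    rw [Finset.card_insert_of_notMem hx]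
    omega

/-- Reaching the maximal count forces each successive change to be a splitting, and splittings only
refine the circles. -/
theorem circleSetoid_mix_le (D : Diagram X C R) (s s' : X → Smoothing) (U : Finset X)
    (h : D.numCircles (mix s s' U) = D.numCircles s + U.card) :
    D.circleSetoid (mix s s' U) ≤ D.circleSetoid s := by
  induction U using Finset.induction_on with
  | empty => simp [mix_empty]
  | insert x U hx ih =>
    have h₁ := D.numCircles_le_add_one (mix_insert_apply s s' U x)
    have h₂ := D.numCircles_mix_le s s' U
    rw [Finset.card_insert_of_notMem hx] at h
    exact (D.circleSetoid_le_of_numCircles_eq (mix_insert_apply s s' U x) (by omega)).trans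
      (ih (by omega))

end Diagram

end SolidTorus

/-! ### Alternating diagrams: self-touching circles and the power of `t`. -/

namespace SolidTorus

/-- The smoothing cuts off the corner `i`. -/
def Smoothing.Keeps (σ : Smoothing) (i : Fin 4) : Prop :=
  σ.join i = i + 1

instance (σ : Smoothing) (i : Fin 4) : Decidable (σ.Keeps i) :=
  inferInstanceAs (Decidable (σ.join i = i + 1))

/-- `A` cuts off the even corners and `B` the odd ones; the hypothesis is the parity change that
alternation gives along an edge. -/
theorem Smoothing.keeps_iff_not (σ : Smoothing) (i j : Fin 4)
    (h : (j = 1 ∨ j = 3) ↔ ¬ (i = 1 ∨ i = 3)) : σ.Keeps j ↔ ¬ σ.Keeps i := by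
  revert σ i j; decide

theorem Smoothing.exists_keeps (σ : Smoothing) : ∃ i, σ.Keeps i := by
  revert σ; decide

theorem Smoothing.Keeps.add_two {σ : Smoothing} {i : Fin 4} (h : σ.Keeps i) :
    σ.Keeps (i + 2) := by
  revert σ i; decide

theorem Smoothing.Keeps.not_add_one {σ : Smoothing} {i : Fin 4} (h : σ.Keeps i) :
    ¬ σ.Keeps (i + 1) := by
  revert σ i; decide

theorem Smoothing.Keeps.join_add_one_of_ne {σ τ : Smoothing} {i : Fin 4} (h : σ.Keeps i)
    (hτ : τ ≠ σ) : τ.join (i + 1) = i + 2 := by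
  revert σ τ i; decide

namespace Diagram

variable {X C R : Type*} [Fintype X] [Fintype C] [Fintype R]

/-! ### Circles of constant states of alternating diagrams -/

/-- The region at an end that lies in the corner that the smoothing `σ` cuts off. -/
def insideRegion (D : Diagram X C R) (σ : Smoothing) (d : X × Fin 4) : R :=
  if σ.Keeps d.2 then D.region d else D.rightRegion d

/-- The region at an end that lies in a corner that is opened by the smoothing `σ`. -/
def outsideRegion (D : Diagram X C R) (σ : Smoothing) (d : X × Fin 4) : R :=
  if σ.Keeps d.2 then D.rightRegion d else D.region d

variable {D : Diagram X C R}

/-- Passing to the other end of an edge exchanges left and right; alternation exchanges the roles of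
the two corners as well, and the two effects cancel. -/
theorem Alternating.insideRegion_glue (hA : D.Alternating) (σ : Smoothing) (d : X × Fin 4) :
    D.insideRegion σ (D.glue d) = D.insideRegion σ d := by
  have h := σ.keeps_iff_not _ _ (hA d)
  unfold insideRegion
  by_cases hd : σ.Keeps d.2 <;> simp [h, hd, region_glue, rightRegion_glue]

theorem Alternating.outsideRegion_glue (hA : D.Alternating) (σ : Smoothing) (d : X × Fin 4) :
    D.outsideRegion σ (D.glue d) = D.outsideRegion σ d := by
  have h := σ.keeps_iff_not _ _ (hA d)
  unfold outsideRegion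
  by_cases hd : σ.Keeps d.2 <;> simp [h, hd, region_glue, rightRegion_glue]

theorem insideRegion_join (D : Diagram X C R) (σ : Smoothing) (x : X) (i : Fin 4) :
    D.insideRegion σ (x, σ.join i) = D.insideRegion σ (x, i) := by
  cases σ <;> fin_cases i <;> rfl

theorem Alternating.insideRegion_eq (hA : D.Alternating) {σ : Smoothing} {d e : X × Fin 4}
    (h : D.circleSetoid (fun _ => σ) d e) : D.insideRegion σ d = D.insideRegion σ e := by
  induction h with
  | rel d e h =>
    rcases h with rfl | rfl
    · exact (hA.insideRegion_glue σ d).symm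
    · exact (D.insideRegion_join σ d.1 d.2).symm
  | refl => rfl
  | symm _ _ _ ih => exact ih.symm
  | trans _ _ _ _ _ ih₁ ih₂ => exact ih₁.trans ih₂

theorem outsideRegion_eq (D : Diagram X C R) (σ : Smoothing) (x : X) (i : Fin 4) :
    D.outsideRegion σ (x, i) = D.region (x, σ.opened) ∨
      D.outsideRegion σ (x, i) = D.region (x, σ.opened + 2) := by
  cases σ <;> fin_cases i
  · exact .inr rfl
  · exact .inl rfl
  · exact .inl rfl
  · exact .inr rfl
  · exact .inl rfl
  · exact .inl rfl
  · exact .inr rfl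
  · exact .inr rfl

/-! ### Crossings where a circle of a constant state touches itself -/

/-- If a circle of a constant state touches itself at the crossing `c`, then the curve that runs
inside the circle from `c` to `c` passes through `c` only. -/
theorem Alternating.exists_curveThrough (hA : D.Alternating) {σ : Smoothing} {s : X → Smoothing}
    {c : X} (hc : s c ≠ σ) (hs : ∀ y, y ≠ c → s y = σ)
    (hle : D.circleSetoid s ≤ D.circleSetoid fun _ => σ) {p : Fin 4} (hp : σ.Keeps p)
    (hne : ¬ D.circleSetoid s (c, p) (c, p + 2)) {f : R → ZMod 2}
    (hf : D.jump f = D.circleIndicator s (D.circleOf s (c, p))) :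
    ∃ γ : D.CurveThrough c, γ.dotSide = decide (f D.dot ≠ f (D.region (c, p))) ∧
      γ.outerSide = decide (f D.outer ≠ f (D.region (c, p))) := by
  have hjoin := D.circleSetoid_join s c (p + 1)
  rw [hp.join_add_one_of_ne hc] at hjoin
  have hjoin' := D.circleSetoid_join s c (p + 2 + 1)
  rw [hp.add_two.join_add_one_of_ne hc] at hjoin'
  have hp4 : p + 2 + 2 = p := by clear * -; revert p; decide
  have hp3 : p + 2 + 1 = p - 1 := by clear * -; revert p; decide
  have hp1 : p + 2 - 1 = p + 1 := by clear * -; revert p; decide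
  have hp5 : p + 2 + 3 = p + 1 := by clear * -; revert p; decide
  -- Both cut-off corners at `c` belong to the one circle of the constant state that splits there,
  -- hence to its inner region, so a curve can join them inside it.
  have hregion : D.region (c, p + 2) = D.region (c, p) := by
    have h₁ := D.circleSetoid_join (fun _ => σ) c p
    rw [show σ.join p = p + 1 from hp] at h₁
    have := hA.insideRegion_eq ((D.circleSetoid _).trans h₁ (hle hjoin))
    simpa [insideRegion, hp, hp.add_two] using this.symm
  have hin {d : X × Fin 4} (hd : D.circleOf s d = D.circleOf s (c, p)) :
      D.insideRegion σ d = D.region (c, p) := by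
    have := hA.insideRegion_eq (hle ((D.circleOf_eq_iff s _ _).1 hd))
    rwa [insideRegion, insideRegion, if_pos (show σ.Keeps (c, p).2 from hp)] at this
  have hout {d : X × Fin 4} (hd : D.circleOf s d ≠ D.circleOf s (c, p)) :
      f (D.region d) = f (D.rightRegion d) :=
    not_not.1 fun h => hd ((D.jump_ne_iff hf d).1 h)
  have hfalse : f (D.region (c, p + 1)) = f (D.region (c, p)) := by
    have := hout (d := (c, p + 2)) fun h =>
      hne ((D.circleSetoid s).symm ((D.circleOf_eq_iff s _ _).1 h))
    rw [rightRegion, hregion] at this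
    simp only [hp1] at this
    exact this.symm
  have htrue : f (D.region (c, p - 1)) ≠ f (D.region (c, p)) :=
    ((D.jump_ne_iff hf (c, p)).2 rfl).symm
  refine ⟨{
    corner := p + 2
    -- The curve is the half circle through `(c, p)` pushed into its inner region. An edge of this
    -- half has different values of `f` on its two sides and lies on the same side of the curve as
    -- its outside region; for all other edges both values agree.
    edgeSide := fun d => decide (f (D.outsideRegion σ d) ≠ f (D.region (c, p)))
    circleSide := fun k => decide (f (D.side k false) ≠ f (D.region (c, p)))
    regionSide := fun r => decide (f r ≠ f (D.region (c, p)))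
    dotSide := decide (f D.dot ≠ f (D.region (c, p)))
    outerSide := decide (f D.outer ≠ f (D.region (c, p)))
    edge_glue := fun d => by rw [hA.outsideRegion_glue]
    edge_crossing := fun x hx i j => ?_
    edge_zero := ?_
    edge_one := ?_
    edge_two := ?_
    edge_three := ?_
    region_edge := fun d hd => ?_
    region_circle := fun k b _ => ?_
    region_dot := fun _ => rfl
    region_outer := fun _ => rfl }, rfl, rfl⟩
  · have hx' := D.apply_opened hf x
    rw [hs x hx] at hx'
    have key (i : Fin 4) : f (D.outsideRegion σ (x, i)) = f (D.region (x, σ.opened)) := by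
      rcases D.outsideRegion_eq σ x i with h | h <;> rw [h]
      exact hx'.symm
    rw [key, key]
  · simp [outsideRegion, rightRegion, hp.add_two, hp1, hfalse]
  · have := hp.add_two.not_add_one
    rw [hp3] at this ⊢
    simpa [outsideRegion, this] using htrue
  · rw [hp4]
    simpa [outsideRegion, hp, rightRegion] using htrue
  · rw [hp5]
    simp [outsideRegion, hp.not_add_one, hfalse]
  · rw [hregion] at hd
    by_cases hk : σ.Keeps d.2
    · have hγ : D.circleOf s d ≠ D.circleOf s (c, p) := fun h => by
        have := hin h
        rw [insideRegion, if_pos hk] at this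
        exact hd this
      rw [outsideRegion, if_pos hk, hout hγ]
    · rw [outsideRegion, if_neg hk]
  · have : f (D.side k false) = f (D.side k true) :=
      not_not.1 fun h => nomatch (D.jump_side_ne_iff hf k).1 h
    cases b
    · rfl
    · rw [this]

/-- The curve parallel to the half circle has the dot and the outer boundary on the sides dictated
by `f`. Equal values would make it contractible, which `hD` forbids. -/
theorem Alternating.winding_eq_one (hA : D.Alternating) (hD : D.DottedReduced) {σ : Smoothing}
    {s : X → Smoothing} {c : X} (hc : s c ≠ σ) (hs : ∀ y, y ≠ c → s y = σ)
    (hle : D.circleSetoid s ≤ D.circleSetoid fun _ => σ) {p : Fin 4} (hp : σ.Keeps p)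
    (hne : ¬ D.circleSetoid s (c, p) (c, p + 2)) :
    D.winding s (D.circleOf s (c, p)) = 1 := by
  obtain ⟨f, hf⟩ := D.exists_jump_eq_circleIndicator s (D.circleOf s (c, p))
  obtain ⟨γ, h₁, h₂⟩ := hA.exists_curveThrough hc hs hle hp hne hf
  rw [D.winding_eq hf]
  have hne : f D.dot ≠ f D.outer := fun h =>
    (hD c ⟨γ⟩).2 ⟨γ, by rw [CurveThrough.Contractible, h₁, h₂, h]⟩
  generalize f D.dot = a at hne
  generalize f D.outer = b at hne
  clear * - hne
  revert a b; decide

/-- A circle of a constant state that touches itself at a dotted-irreducible crossing does not go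
around the dot. -/
theorem Alternating.winding_const_eq_zero (hA : D.Alternating) (hD : D.DottedReduced)
    {σ : Smoothing} {s : X → Smoothing} {c : X} (hc : s c ≠ σ) (hs : ∀ y, y ≠ c → s y = σ)
    (hle : D.circleSetoid s ≤ D.circleSetoid fun _ => σ) {p : Fin 4} (hp : σ.Keeps p)
    (hne : ¬ D.circleSetoid s (c, p) (c, p + 2)) :
    D.winding (fun _ => σ) (D.circleOf (fun _ => σ) (c, p)) = 0 := by
  classical
  have : Fintype (D.Circle s) := Fintype.ofFinite _
  have hp4 : p + 2 + 2 = p := by clear * -; revert p; decide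
  -- The circle consists of exactly two halves, through the opposite ends `p` and `p + 2`; each has
  -- winding number `1`.
  have hpair : ({γ | D.coarsen hle γ = D.circleOf (fun _ => σ) (c, p)} : Finset (D.Circle s)) =
      {D.circleOf s (c, p), D.circleOf s (c, p + 2)} := by
    have hjoin := D.circleSetoid_join s c (p + 1)
    rw [hp.join_add_one_of_ne hc] at hjoin
    have hj := D.circleSetoid_join (fun _ => σ) c p
    rw [show σ.join p = p + 1 from hp] at hj
    ext γ
    simp only [Finset.mem_filter, Finset.mem_univ, true_and, Finset.mem_insert,
      Finset.mem_singleton]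
    constructor
    · intro hγ
      rcases γ with z | k
      · induction z using Quotient.inductionOn with | h d => ?_
        have hd : D.circleSetoid (fun _ => σ) d (c, p) := (D.circleOf_eq_iff _ _ _).1 hγ
        have hend (j : Fin 4) (h : D.circleSetoid s d (c, j)) :
            D.circleSetoid s d (c, p) ∨ D.circleSetoid s d (c, p + 2) :=
          (D.circleSetoid_or_circleSetoid_opposite s c j p).imp
            (fun h' => (D.circleSetoid s).trans h h') fun h' => (D.circleSetoid s).trans h h'
        have : D.circleSetoid s d (c, p) ∨ D.circleSetoid s d (c, p + 2) := by
          rcases D.circleSetoid_le_mergedSetoid (fun y hy => (hs y hy).symm) hd with h | ⟨h | h, _⟩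
          · exact .inl h
          · exact hend 0 h
          · exact hend 2 h
        exact this.imp (D.circleOf_eq_iff s _ _).2 (D.circleOf_eq_iff s _ _).2
      · exact nomatch hγ
    · rintro (rfl | rfl)
      · rfl
      · rw [coarsen_circleOf, circleOf_eq_iff]
        exact (D.circleSetoid _).symm ((D.circleSetoid _).trans hj (hle hjoin))
  rw [D.winding_eq_sum_coarsen hle, hpair, Finset.sum_pair fun h =>
    hne ((D.circleOf_eq_iff s _ _).1 h), hA.winding_eq_one hD hc hs hle hp hne,
    hA.winding_eq_one hD hc hs hle hp.add_two fun h =>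
      hne ((D.circleSetoid s).symm (by rwa [hp4] at h))]
  rfl

theorem exists_aroundDot_of_winding_ne_zero (D : Diagram X C R) {s s' : X → Smoothing}
    (hle : D.circleSetoid s' ≤ D.circleSetoid s) {γ : D.Circle s} (h : D.winding s γ ≠ 0) :
    ∃ γ' : {γ' : D.Circle s' // D.AroundDot s' γ'}, D.coarsen hle γ' = γ := by
  classical
  have : Fintype (D.Circle s') := Fintype.ofFinite _
  rw [D.winding_eq_sum_coarsen hle] at h
  obtain ⟨γ', hγ', hne⟩ := Finset.exists_ne_zero_of_sum_ne_zero h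
  exact ⟨⟨γ', (D.aroundDot_iff_winding s' γ').2 hne⟩, (Finset.mem_filter.1 hγ').2⟩

/-! ### Comparison of a state with a constant state -/

variable [DecidableEq X]

theorem mix_filter_ne (σ : Smoothing) (s : X → Smoothing) :
    mix (fun _ => σ) s (Finset.univ.filter fun x => s x ≠ σ) = s := by
  funext x
  by_cases h : s x = σ <;> simp [mix, h]

theorem numCircles_le_const (D : Diagram X C R) (σ : Smoothing) (s : X → Smoothing) :
    D.numCircles s ≤
      D.numCircles (fun _ => σ) + (Finset.univ.filter fun x => s x ≠ σ).card := by
  have := D.numCircles_mix_le (fun _ => σ) s (Finset.univ.filter fun x => s x ≠ σ)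
  rwa [mix_filter_ne] at this

theorem Alternating.numAroundDot_const_lt (hA : D.Alternating) (hD : D.DottedReduced)
    {σ : Smoothing} {s : X → Smoothing} {c : X} (hc : s c ≠ σ)
    (hcard : D.numCircles s =
      D.numCircles (fun _ => σ) + (Finset.univ.filter fun x => s x ≠ σ).card) :
    D.numAroundDot (fun _ => σ) < D.numAroundDot s := by
  classical
  set U := Finset.univ.filter fun x => s x ≠ σ with hU
  have hcU : c ∈ U := by simp [hU, hc]
  -- The crossing `c` is changed first, so that the splitting there happens to a circle of the
  -- constant state.
  let s₁ := mix (fun _ => σ) s {c}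
  have hs₁c : s₁ c ≠ σ := by simpa [s₁, mix] using hc
  have hs₁ (y : X) (hy : y ≠ c) : s₁ y = σ := by simp [s₁, mix, hy]
  have hmix : mix s₁ s (U.erase c) = s := by
    funext x
    by_cases hx : s x = σ <;> by_cases hxc : x = c <;> simp [mix, s₁, hU, hx, hxc]
  have hcardU := Finset.card_erase_add_one hcU
  have h₁ := D.numCircles_mix_le s₁ s (U.erase c)
  have h₂ := D.numCircles_le_add_one (s := fun _ => σ) fun y hy => (hs₁ y hy).symm
  have hle₁ := D.circleSetoid_mix_le s₁ s (U.erase c)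
  rw [hmix] at h₁ hle₁
  replace hle₁ := hle₁ (by omega)
  have hcard₁ : D.numCircles s₁ = D.numCircles (fun _ => σ) + 1 := by omega
  have hle := D.circleSetoid_le_of_numCircles_eq (fun y hy => (hs₁ y hy).symm) hcard₁
  have hne := D.not_circleSetoid_of_numCircles_eq (fun y hy => (hs₁ y hy).symm) hcard₁
  obtain ⟨p, hp⟩ := σ.exists_keeps
  have hone := hA.winding_eq_one hD hs₁c hs₁ hle hp (hne p)
  have hzero := hA.winding_const_eq_zero hD hs₁c hs₁ hle hp (hne p)
  let T := {γ : D.Circle (fun _ => σ) // D.AroundDot (fun _ => σ) γ}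
  -- The extra value `none` stands for the circle split at `c`: its winding number is `0`, so it is
  -- not among those around the dot.
  let target : Option T → D.Circle (fun _ => σ) := fun o =>
    o.elim (D.circleOf _ (c, p)) Subtype.val
  have htarget : Function.Injective target := by
    have hnot (γ : T) : γ.1 ≠ D.circleOf _ (c, p) := fun h =>
      (D.aroundDot_iff_winding _ _).1 γ.2 (h ▸ hzero)
    rintro (_ | γ) (_ | γ') h
    · rfl
    · exact absurd h.symm (hnot γ')
    · exact absurd h (hnot γ)
    · exact congrArg some (Subtype.ext h)
  have hlift (o : Option T) : ∃ γ' : {γ' : D.Circle s // D.AroundDot s γ'},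
      D.coarsen (hle₁.trans hle) γ' = target o := by
    rcases o with _ | γ
    -- The even circle itself guarantees nothing, but its half in `s₁` is odd and therefore contains
    -- an odd circle of `s`.
    · obtain ⟨γ', h⟩ := D.exists_aroundDot_of_winding_ne_zero hle₁
        (γ := D.circleOf s₁ (c, p)) (by rw [hone]; exact one_ne_zero)
      refine ⟨γ', ?_⟩
      have : D.coarsen hle (D.coarsen hle₁ γ'.1) = D.coarsen (hle₁.trans hle) γ'.1 := by
        rcases γ'.1 with z | k
        · induction z using Quotient.inductionOn with | h d => rfl
        · rfl
      rw [← this, h]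
      rfl
    · exact D.exists_aroundDot_of_winding_ne_zero _ ((D.aroundDot_iff_winding _ _).1 γ.2)
  choose lift hlift using hlift
  have hinj : Function.Injective lift := fun o o' h =>
    htarget (by rw [← hlift, ← hlift, h])
  have := Nat.card_le_card_of_injective lift hinj
  rw [Finite.card_option] at this
  exact this

end Diagram

end SolidTorus

/-! ### Extreme coefficients of the contributions and of the bracket. -/

namespace SolidTorus

open LaurentPolynomial

/-! ### Extreme coefficients -/

theorem coeff_mul_T {S : Type*} [Semiring S] (f : LaurentPolynomial S) (n k : ℤ) :
    (f * T n).coeff k = f.coeff (k - n) := by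
  rw [T, AddMonoidAlgebra.coeff_mul_single_apply, mul_one, sub_eq_add_neg]

theorem coeff_mul_C {S : Type*} [Semiring S] (f : LaurentPolynomial S) (a : S) (k : ℤ) :
    (f * LaurentPolynomial.C a).coeff k = f.coeff k * a := by
  rw [← single_eq_C, AddMonoidAlgebra.coeff_mul_single_zero]

/-- The exponents of `A` that are extreme for the two smoothings: the largest ones for the
`A`-smoothing, the smallest ones for the `B`-smoothing. -/
def Smoothing.sign : Smoothing → ℤ
  | .A => 1
  | .B => -1

/-- Multiplication by `σ.sign` turns lowest exponents into highest ones, so one induction treats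
both ends of the polynomial. -/
theorem coeff_loop_pow (σ : Smoothing) (m : ℕ) :
    (∀ k : ℤ, 2 * m < σ.sign * k →
      ((-T 2 - T (-2) : LaurentPolynomial (Polynomial ℤ)) ^ m).coeff k = 0) ∧
    ((-T 2 - T (-2) : LaurentPolynomial (Polynomial ℤ)) ^ m).coeff (σ.sign * (2 * m)) =
      (-1) ^ m := by
  induction m with
  | zero =>
    rw [pow_zero, ← T_zero]
    refine ⟨fun k hk => ?_, by simp⟩
    rw [T_apply, if_neg]
    rintro rfl
    simp at hk
  | succ m ih =>
    have hstep (k : ℤ) :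
        ((-T 2 - T (-2) : LaurentPolynomial (Polynomial ℤ)) ^ (m + 1)).coeff k =
          -((-T 2 - T (-2) : LaurentPolynomial (Polynomial ℤ)) ^ m).coeff (k - 2) -
            ((-T 2 - T (-2) : LaurentPolynomial (Polynomial ℤ)) ^ m).coeff (k + 2) := by
      have h (f : LaurentPolynomial (Polynomial ℤ)) :
          f * (-T 2 - T (-2)) = -(f * T 2) - f * T (-2) := by ring
      rw [pow_succ, h, AddMonoidAlgebra.coeff_sub, AddMonoidAlgebra.coeff_neg,
        Finsupp.sub_apply, Finsupp.neg_apply, coeff_mul_T, coeff_mul_T, sub_neg_eq_add]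
    obtain ⟨h₁, h₂⟩ := ih
    refine ⟨fun k hk => ?_, ?_⟩
    · rw [hstep, h₁, h₁, neg_zero, sub_zero]
      all_goals cases σ <;> simp only [Smoothing.sign] at hk ⊢ <;> push_cast at hk <;> omega
    · rw [hstep, pow_succ, ← h₂]
      cases σ
      · rw [h₁ (_ + 2) (by simp only [Smoothing.sign]; push_cast; omega)]
        simp only [Smoothing.sign]
        push_cast
        ring_nf
      · rw [h₁ (_ - 2) (by simp only [Smoothing.sign]; push_cast; omega)]
        simp only [Smoothing.sign]
        push_cast
        ring_nf

theorem maxDegA_eq {f : LaurentPolynomial (Polynomial ℤ)} {n : ℤ} (h : f.coeff n ≠ 0)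
    (h' : ∀ k, n < k → f.coeff k = 0) : maxDegA f = n := by
  refine le_antisymm (Finset.max_le fun k hk => ?_)
    (Finset.le_max (Finsupp.mem_support_iff.2 h))
  exact WithBot.coe_le_coe.2 (not_lt.1 fun hlt => Finsupp.mem_support_iff.1 hk (h' k hlt))

theorem minDegA_eq {f : LaurentPolynomial (Polynomial ℤ)} {n : ℤ} (h : f.coeff n ≠ 0)
    (h' : ∀ k, k < n → f.coeff k = 0) : minDegA f = n := by
  refine le_antisymm (Finset.min_le (Finsupp.mem_support_iff.2 h))
    (Finset.le_min fun k hk => ?_)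
  exact WithTop.coe_le_coe.2 (not_lt.1 fun hlt => Finsupp.mem_support_iff.1 hk (h' k hlt))

namespace Diagram

variable {X C R : Type*} [Fintype X] [Fintype C] [Fintype R]

theorem sign_mul_sub_eq (σ : Smoothing) (s : X → Smoothing) :
    σ.sign * (((Finset.univ.filter fun x => s x = Smoothing.A).card : ℤ) -
      ((Finset.univ.filter fun x => s x = Smoothing.B).card : ℤ)) =
      Fintype.card X - 2 * (Finset.univ.filter fun x => s x ≠ σ).card := by
  have hA := Finset.card_filter_add_card_filter_not (s := Finset.univ) fun x => s x = Smoothing.A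
  have hB := Finset.card_filter_add_card_filter_not (s := Finset.univ) fun x => s x = Smoothing.B
  have hAB : (Finset.univ.filter fun x => ¬ s x = Smoothing.A) =
      Finset.univ.filter fun x => s x = Smoothing.B :=
    Finset.filter_congr fun x _ => by cases s x <;> simp
  rw [hAB] at hA
  rw [Finset.card_univ] at hA hB
  cases σ <;> simp only [Smoothing.sign, ne_eq]
  · rw [hAB]; omega
  · omega

/-- This keeps the natural-number subtraction in the exponent `|S| - 1` from being truncated. -/
theorem numCircles_pos (D : Diagram X C R) (s : X → Smoothing) : 0 < D.numCircles s := by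
  have : Nonempty (D.Circle s) := by
    obtain ⟨x | k⟩ := D.nonempty
    · exact ⟨D.circleOf s (x, 0)⟩
    · exact ⟨.inr k⟩
  exact Nat.card_pos

/-- The extreme exponent of the contribution of a state, up to the sign. -/
noncomputable def extremeExponent (D : Diagram X C R) (σ : Smoothing) (s : X → Smoothing) : ℤ :=
  Fintype.card X - 2 * (Finset.univ.filter fun x => s x ≠ σ).card + 2 * (D.numCircles s - 1 : ℕ)

theorem coeff_contribution (D : Diagram X C R) (s : X → Smoothing) (k : ℤ) :
    (D.contribution s).coeff k =
      ((-T 2 - T (-2) : LaurentPolynomial (Polynomial ℤ)) ^ (D.numCircles s - 1)).coeff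
        (k - (((Finset.univ.filter fun x => s x = Smoothing.A).card : ℤ) -
          ((Finset.univ.filter fun x => s x = Smoothing.B).card : ℤ))) *
        Polynomial.X ^ D.numAroundDot s := by
  rw [contribution, coeff_mul_C, T_mul, coeff_mul_T]

theorem coeff_contribution_of_lt (D : Diagram X C R) (σ : Smoothing) (s : X → Smoothing) {k : ℤ}
    (hk : D.extremeExponent σ s < σ.sign * k) : (D.contribution s).coeff k = 0 := by
  rw [coeff_contribution, (coeff_loop_pow σ _).1, zero_mul]
  rw [mul_sub, sign_mul_sub_eq]
  rw [extremeExponent] at hk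
  linarith

theorem _root_.SolidTorus.Smoothing.sign_mul_sign (σ : Smoothing) : σ.sign * σ.sign = 1 := by
  cases σ <;> rfl

theorem coeff_contribution_extreme (D : Diagram X C R) (σ : Smoothing) (s : X → Smoothing) :
    (D.contribution s).coeff (σ.sign * D.extremeExponent σ s) =
      (-1) ^ (D.numCircles s - 1) * Polynomial.X ^ D.numAroundDot s := by
  rw [coeff_contribution, ← (coeff_loop_pow σ _).2]
  congr 2
  rw [extremeExponent, ← sign_mul_sub_eq, mul_add, ← mul_assoc, σ.sign_mul_sign, one_mul]
  ring

theorem numCircles_eq_of_extremeExponent_eq (D : Diagram X C R) {σ : Smoothing}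
    {s : X → Smoothing} (h : D.extremeExponent σ s = D.extremeExponent σ fun _ => σ) :
    D.numCircles s =
      D.numCircles (fun _ => σ) + (Finset.univ.filter fun x => s x ≠ σ).card := by
  have h₀ := D.numCircles_pos fun _ => σ
  have h₁ := D.numCircles_pos s
  simp only [extremeExponent, ne_eq, not_true, Finset.filter_false, Finset.card_empty] at h ⊢
  omega

theorem coeff_contribution_const_ne_zero (D : Diagram X C R) (σ : Smoothing) :
    (D.contribution fun _ => σ).coeff (σ.sign * D.extremeExponent σ fun _ => σ) ≠ 0 := by
  rw [coeff_contribution_extreme]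
  exact mul_ne_zero (pow_ne_zero _ (neg_ne_zero.2 one_ne_zero))
    (pow_ne_zero _ Polynomial.X_ne_zero)

variable [DecidableEq X]

/-- Each changed smoothing costs `2` in the power of `A` and gains at most one circle, worth `2`. -/
theorem extremeExponent_le (D : Diagram X C R) (σ : Smoothing) (s : X → Smoothing) :
    D.extremeExponent σ s ≤ D.extremeExponent σ fun _ => σ := by
  have h := D.numCircles_le_const σ s
  have h₀ := D.numCircles_pos fun _ => σ
  have h₁ := D.numCircles_pos s
  simp only [extremeExponent, ne_eq, not_true, Finset.filter_false, Finset.card_empty] at h ⊢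
  omega

theorem coeff_bracket (D : Diagram X C R) (k : ℤ) :
    D.bracket.coeff k = ∑ s : X → Smoothing, (D.contribution s).coeff k := by
  rw [bracket, AddMonoidAlgebra.coeff_sum, Finsupp.finsetSum_apply]

theorem coeff_bracket_of_lt (D : Diagram X C R) (σ : Smoothing) {k : ℤ}
    (hk : D.extremeExponent σ (fun _ => σ) < σ.sign * k) : D.bracket.coeff k = 0 := by
  rw [coeff_bracket]
  exact Finset.sum_eq_zero fun s _ =>
    D.coeff_contribution_of_lt σ s ((D.extremeExponent_le σ s).trans_lt hk)

/-- In the extreme coefficient of the bracket, the constant state alone contributes to the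
smallest power of `t`. -/
theorem Alternating.coeff_bracket_ne_zero {D : Diagram X C R} (hA : D.Alternating)
    (hD : D.DottedReduced) (σ : Smoothing) :
    D.bracket.coeff (σ.sign * D.extremeExponent σ fun _ => σ) ≠ 0 := by
  intro h
  -- At this power of `t` other states contribute nothing: they either miss the extreme exponent of
  -- `A` or have strictly more circles around the dot.
  have hcoeff := congrArg (fun q => Polynomial.coeff q (D.numAroundDot fun _ => σ)) h
  rw [coeff_bracket] at hcoeff
  simp only [Polynomial.finsetSum_coeff, Polynomial.coeff_zero] at hcoeff
  have hsign (m : ℕ) : ((-1) ^ m : Polynomial ℤ) = Polynomial.C ((-1) ^ m) := by simp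
  rw [Finset.sum_eq_single (fun _ => σ), coeff_contribution_extreme, hsign,
    Polynomial.coeff_C_mul, Polynomial.coeff_X_pow_self, mul_one] at hcoeff
  · exact pow_ne_zero _ (by decide) hcoeff
  · intro s _ hs
    obtain ⟨c, hc⟩ := Function.ne_iff.1 hs
    rcases (D.extremeExponent_le σ s).lt_or_eq with hlt | heq
    · rw [D.coeff_contribution_of_lt σ s, Polynomial.coeff_zero]
      rwa [← mul_assoc, σ.sign_mul_sign, one_mul]
    · rw [← heq, coeff_contribution_extreme, hsign, Polynomial.coeff_C_mul, Polynomial.coeff_X_pow,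
        if_neg, mul_zero]
      exact (hA.numAroundDot_const_lt hD hc (D.numCircles_eq_of_extremeExponent_eq heq)).ne
  · exact fun h => absurd (Finset.mem_univ _) h

end Diagram

end SolidTorus

theorem theorem4p1 {X C R : Type*} [Fintype X] [Fintype C] [Fintype R] [DecidableEq X]
    (D : SolidTorus.Diagram X C R) (hA : D.Alternating) (hD : D.DottedReduced) :
    SolidTorus.maxDegA D.bracket =
        SolidTorus.maxDegA (D.contribution fun _ => SolidTorus.Smoothing.A) ∧
      SolidTorus.minDegA D.bracket =
        SolidTorus.minDegA (D.contribution fun _ => SolidTorus.Smoothing.B) := by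
  constructor
  · rw [SolidTorus.maxDegA_eq (hA.coeff_bracket_ne_zero hD .A) fun k hk =>
        D.coeff_bracket_of_lt .A (by simp only [SolidTorus.Smoothing.sign] at hk ⊢; linarith),
      SolidTorus.maxDegA_eq (D.coeff_contribution_const_ne_zero .A) fun k hk =>
        D.coeff_contribution_of_lt .A _
          (by simp only [SolidTorus.Smoothing.sign] at hk ⊢; linarith)]
  · rw [SolidTorus.minDegA_eq (hA.coeff_bracket_ne_zero hD .B) fun k hk =>
        D.coeff_bracket_of_lt .B (by simp only [SolidTorus.Smoothing.sign] at hk ⊢; linarith),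
      SolidTorus.minDegA_eq (D.coeff_contribution_const_ne_zero .B) fun k hk =>
        D.coeff_contribution_of_lt .B _
          (by simp only [SolidTorus.Smoothing.sign] at hk ⊢; linarith)]
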